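/- Let $d$ be a natural number. There is a constant $c=c(d)>0$, depending only on $d$, such that the following holds for every $n$. Let $P\subset\mathbb R^d$ be a set of $n$ points in general position, that is, no $d+1$ points of $P$ are contained in a hyperplane. Then there exists a point of $\mathbb R^d$ that is contained in at least $c\binom{n}{d+1}$ of the $d$-dimensional simplices spanned by $P$, that is, of the convex hulls of the $(d+1)$-point subsets of $P$. -/

import Mathlib

/-- A hyperplane of `ℝ^d`: the solution set of one linear equation `⟪a, x⟫ = b` with `a ≠ 0`. -/
def IsHyperplane {d : ℕ} (H : Set (EuclideanSpace ℝ (Fin d))) : Prop :=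
  ∃ a : EuclideanSpace ℝ (Fin d), a ≠ 0 ∧ ∃ b : ℝ, H = {x | inner ℝ a x = b}

/-- A finite set of points of `ℝ^d` is in general position if no `d + 1` of its points are
contained in a hyperplane. -/
def InGeneralPosition {d : ℕ} (P : Finset (EuclideanSpace ℝ (Fin d))) : Prop :=
  ∀ S : Finset (EuclideanSpace ℝ (Fin d)), S ⊆ P → S.card = d + 1 →
    ∀ H : Set (EuclideanSpace ℝ (Fin d)), IsHyperplane H →
      ¬ (S : Set (EuclideanSpace ℝ (Fin d))) ⊆ H

/-- The `k`-dimensional simplices spanned by `P` (for `P` in general position): the convex hulls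
of the subsets of `P` with exactly `k + 1` points. They are collected as sets of points, so each
simplex is counted once. -/
def spannedSimplices {d : ℕ} (k : ℕ) (P : Finset (EuclideanSpace ℝ (Fin d))) :
    Set (Set (EuclideanSpace ℝ (Fin d))) :=
  {Δ | ∃ S : Finset (EuclideanSpace ℝ (Fin d)), S ⊆ P ∧ S.card = k + 1 ∧
    Δ = convexHull ℝ (S : Set (EuclideanSpace ℝ (Fin d)))}

/-! Let `x` be a centerpoint of `P`. Removing Carathéodory simplices around `x` greedily gives `m ≈
n / (d + 1) ^ 2` disjoint subsets of `P` whose hulls contain `x`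
(`exists_pairwiseDisjoint_mem_convexHull`). By colorful Carathéodory
(`exists_transversal_mem_convexHull`), any `d + 1` of them have a transversal whose hull contains
`x`. Disjointness and general position make these simplices distinct, so `x` lies in at least
`m.choose (d + 1)` of them, a constant fraction of all once `m ≥ d + 1`. -/

theorem choose_le_mul_choose_of_le_mul {n m r : ℕ} (hr : 0 < r) (h : n ≤ m * r ^ 2) :
    n.choose r ≤ (r ^ 3) ^ r * max 1 (m.choose r) := by
  rcases lt_or_ge m r with hm | hm
  · calc n.choose r ≤ n ^ r := Nat.choose_le_pow n r
      _ ≤ (r ^ 3) ^ r := by gcongr; nlinarith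
      _ ≤ _ := Nat.le_mul_of_pos_right _ (by simp)
  -- Since `r ≤ m`, `m ≤ r * (m + 1 - r)`.
  · have h1 : n ^ r ≤ (r ^ 3) ^ r * (m + 1 - r) ^ r := by
      rw [← mul_pow]
      gcongr
      obtain ⟨k, rfl⟩ := Nat.exists_eq_add_of_le hm
      have : r + k + 1 - r = k + 1 := by omega
      rw [this]
      have h2 : r + k ≤ r * (k + 1) := by nlinarith
      nlinarith [Nat.mul_le_mul_right (r ^ 2) h2]
    have h2 := n.descFactorial_le_pow r
    have h3 := m.pow_sub_le_descFactorial r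
    rw [Nat.descFactorial_eq_factorial_mul_choose] at h2 h3
    have h4 : r.factorial * n.choose r ≤ r.factorial * ((r ^ 3) ^ r * m.choose r) := by
      calc _ ≤ _ := h2
        _ ≤ _ := h1
        _ ≤ (r ^ 3) ^ r * (r.factorial * m.choose r) := by gcongr
        _ = _ := by ring
    exact (Nat.le_of_mul_le_mul_left h4 r.factorial_pos).trans (by gcongr; simp)

/-! ### Colorful Carathéodory. -/

section InnerProduct
variable {E : Type*} [NormedAddCommGroup E] [InnerProductSpace ℝ E]

theorem inner_sub_nonneg_of_norm_sub_le {K : Set E} (hK : Convex ℝ K) {x p y : E} (hp : p ∈ K)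
    (hy : y ∈ K) (hmin : ∀ z ∈ K, ‖p - x‖ ≤ ‖z - x‖) : 0 ≤ inner ℝ (p - x) (y - p) := by
  have : ‖x - p‖ = ⨅ w : K, ‖x - w‖ := by
    have : Nonempty K := ⟨⟨p, hp⟩⟩
    apply le_antisymm
    · exact le_ciInf fun w => by rw [norm_sub_rev x p, norm_sub_rev x]; exact hmin w w.2
    · exact ciInf_le ⟨0, by rintro _ ⟨w, rfl⟩; positivity⟩ (⟨p, hp⟩ : K)
  have h := (norm_eq_iInf_iff_real_inner_le_zero hK hp).1 this y hy
  rw [← neg_sub p x, inner_neg_left] at h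
  linarith

/-- Colorful Carathéodory theorem, for families none of whose transversals lies in a hyperplane. -/
theorem exists_transversal_mem_convexHull {ι : Type*} [Fintype ι] [Nonempty ι] {F : ι → Finset E} {x : E}
    (hx : ∀ i, x ∈ convexHull ℝ (F i : Set E))
    (hF : ∀ a : ι → E, (∀ i, a i ∈ F i) → ∀ v ≠ 0, ∀ b : ℝ, ∃ i, inner ℝ v (a i) ≠ b) :
    ∃ a : ι → E, (∀ i, a i ∈ F i) ∧ x ∈ convexHull ℝ (Set.range a) := by
  classical
  set T : Set (ι → E) := {a | ∀ i, a i ∈ F i}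
  have hT : T.Finite := by
    refine (Fintype.piFinset F).finite_toSet.subset fun a ha => ?_
    simpa [T] using ha
  have hK : IsCompact (⋃ a ∈ T, convexHull ℝ (Set.range a)) :=
    hT.isCompact_biUnion fun a _ => (Set.finite_range a).isCompact_convexHull ℝ
  have hne (i) : (F i).Nonempty := by
    have := convexHull_nonempty_iff.1 ⟨x, hx i⟩
    simpa using this
  choose a₀ ha₀ using hne
  have hKne : (⋃ a ∈ T, convexHull ℝ (Set.range a)).Nonempty :=
    ⟨a₀ (Classical.arbitrary ι), Set.mem_biUnion (show a₀ ∈ T from ha₀) (subset_convexHull ℝ _ ⟨_, rfl⟩)⟩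
  -- `p` is a point nearest to `x` among all transversal hulls; if `p ≠ x`, exchanging one vertex
  -- gives a contradiction.
  obtain ⟨p, hpK, hmin⟩ := hK.exists_isMinOn hKne (f := fun z => ‖z - x‖)
    (by fun_prop)
  obtain ⟨a, ha, hpa⟩ := Set.mem_iUnion₂.1 hpK
  replace hmin (b) (hb : b ∈ T) (z) (hz : z ∈ convexHull ℝ (Set.range b)) : ‖p - x‖ ≤ ‖z - x‖ :=
    hmin (Set.mem_biUnion hb hz)
  refine ⟨a, ha, ?_⟩
  by_cases hpx : p = x
  · exact hpx ▸ hpa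
  exfalso
  have hpx' : p - x ≠ 0 := sub_ne_zero.2 hpx
  rw [convexHull_range_eq_exists_affineCombination] at hpa
  obtain ⟨s, w', hw0', hw1', hp'⟩ := hpa
  obtain ⟨w, hw0, hw1, hp⟩ : ∃ w : ι → ℝ, (∀ i, 0 ≤ w i) ∧ ∑ i, w i = 1 ∧
      ∑ i, w i • a i = p := by
    refine ⟨fun i => if i ∈ s then w' i else 0, fun i => ?_, ?_, ?_⟩
    · dsimp only; split_ifs with h
      exacts [hw0' i h, le_rfl]
    · simpa using hw1'
    · rw [← hp', s.affineCombination_eq_linear_combination _ _ hw1']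
      simp [ite_smul]
  have hpmem : p ∈ convexHull ℝ (Set.range a) :=
    mem_convexHull_of_exists_fintype w a hw0 hw1 (fun i => ⟨i, rfl⟩) hp
  have hsep (i) : 0 ≤ inner ℝ (p - x) (a i - p) :=
    inner_sub_nonneg_of_norm_sub_le (convex_convexHull ℝ (Set.range a)) hpmem
      (subset_convexHull ℝ _ ⟨i, rfl⟩) (hmin a ha)
  -- If all weights were positive, every `a i` would lie on the hyperplane through `p` normal to `p
  -- - x`.
  obtain ⟨j, hj⟩ : ∃ j, w j = 0 := by
    by_contra! hw
    have hsum : ∑ i, w i * inner ℝ (p - x) (a i - p) = 0 := by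
      have : ∑ i, w i • (a i - p) = 0 := by
        simp [smul_sub, Finset.sum_sub_distrib, hp, ← Finset.sum_smul, hw1]
      simp_rw [← inner_smul_right, ← inner_sum]
      rw [this, inner_zero_right]
    rw [Finset.sum_eq_zero_iff_of_nonneg fun i _ => mul_nonneg (hw0 i) (hsep i)] at hsum
    obtain ⟨i, hi⟩ := hF a ha (p - x) hpx' (inner ℝ (p - x) p)
    have := hsum i (Finset.mem_univ i)
    rw [mul_eq_zero_iff_left (hw i), inner_sub_right] at this
    exact hi (by linarith)
  obtain ⟨y, hyF, hy⟩ : ∃ y ∈ F j, inner ℝ (p - x) y ≤ inner ℝ (p - x) x := by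
    by_contra! h
    have hc : Convex ℝ {y : E | inner ℝ (p - x) x < inner ℝ (p - x) y} :=
      convex_halfSpace_gt (innerₛₗ ℝ (p - x)).isLinear _
    have hxx : x ∈ {y : E | inner ℝ (p - x) x < inner ℝ (p - x) y} :=
      convexHull_min (fun y hy => h y hy) hc (hx j)
    exact lt_irrefl (inner ℝ (p - x) x : ℝ) hxx
  have hb : Function.update a j y ∈ T := by
    intro i
    rcases eq_or_ne i j with rfl | hij
    · simpa using hyF
    · simpa [hij] using ha i
  -- As `w j = 0`, replacing `a j` keeps `p` in the hull, but `y` lies strictly on the side of `x`,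
  -- against minimality.
  have hpb : p ∈ convexHull ℝ (Set.range (Function.update a j y)) := by
    refine mem_convexHull_of_exists_fintype w _ hw0 hw1 (fun i => ⟨i, rfl⟩) ?_
    rw [← hp]
    refine Finset.sum_congr rfl fun i _ => ?_
    rcases eq_or_ne i j with rfl | hij
    · simp [hj]
    · simp [hij]
  have := inner_sub_nonneg_of_norm_sub_le (convex_convexHull ℝ _) hpb
    (subset_convexHull ℝ _ ⟨j, Function.update_self j y a⟩) (hmin _ hb)
  have hpos : 0 < inner ℝ (p - x) (p - x) := real_inner_self_pos.2 hpx'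
  rw [inner_sub_right] at this hpos
  linarith

end InnerProduct

/-! ### Centerpoints and disjoint sets around one point. -/

section Convex
variable {E : Type*} [AddCommGroup E] [Module ℝ E] [FiniteDimensional ℝ E]
open Module

/-- Existence of centerpoints, in terms of the convex hulls of large subsets. -/
theorem exists_forall_mem_convexHull_of_card_lt (P : Finset E) :
    ∃ x : E, ∀ S ⊆ P, finrank ℝ E * P.card < (finrank ℝ E + 1) * S.card →
      x ∈ convexHull ℝ (S : Set E) := by
  classical
  set d := finrank ℝ E
  obtain ⟨x, hx⟩ := Convex.helly_theorem' (𝕜 := ℝ)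
    (F := fun S : Finset E => convexHull ℝ (S : Set E))
    (s := P.powerset.filter fun S => d * P.card < (d + 1) * S.card)
    (fun _ _ => convex_convexHull ℝ _) (by
      intro I hI hcard
      rcases I.eq_empty_or_nonempty with rfl | hIne
      · simp
      -- Each complement has fewer than `|P| / (d + 1)` points, so `d + 1` of them cannot cover `P`.
      have hS (S) (hS : S ∈ I) : (d + 1) * (P \ S).card < P.card := by
        have := hI hS
        rw [Finset.mem_filter, Finset.mem_powerset] at this
        have h := Finset.card_sdiff_add_card_eq_card this.1
        nlinarith
      have hlt : (d + 1) * (I.biUnion fun S => P \ S).card < (d + 1) * P.card :=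
        calc (d + 1) * (I.biUnion fun S => P \ S).card
            ≤ (d + 1) * ∑ S ∈ I, (P \ S).card := by gcongr; exact Finset.card_biUnion_le
          _ = ∑ S ∈ I, (d + 1) * (P \ S).card := Finset.mul_sum ..
          _ < ∑ S ∈ I, P.card := Finset.sum_lt_sum_of_nonempty hIne hS
          _ = I.card * P.card := by simp
          _ ≤ (d + 1) * P.card := by gcongr
      obtain ⟨y, hyP, hy⟩ := Finset.exists_mem_notMem_of_card_lt_card (Nat.lt_of_mul_lt_mul_left hlt)
      refine ⟨y, Set.mem_iInter₂.2 fun S hS => subset_convexHull ℝ _ ?_⟩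
      by_contra hyS
      exact hy (Finset.mem_biUnion.2 ⟨S, hS, Finset.mem_sdiff.2 ⟨hyP, hyS⟩⟩))
  refine ⟨x, fun S hSP hS => Set.mem_iInter₂.1 hx S ?_⟩
  simpa using ⟨hSP, hS⟩

/-- A weak form of Tverberg's theorem. -/
theorem exists_pairwiseDisjoint_mem_convexHull (P : Finset E) :
    ∃ x : E, ∀ m : ℕ, m * (finrank ℝ E + 1) ^ 2 < P.card + (finrank ℝ E + 1) ^ 2 →
      ∃ F : ℕ → Finset E, (∀ i < m, F i ⊆ P ∧ (F i).card ≤ finrank ℝ E + 1 ∧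
        x ∈ convexHull ℝ (F i : Set E)) ∧ ∀ i < m, ∀ j < m, i ≠ j → Disjoint (F i) (F j) := by
  classical
  obtain ⟨x, hx⟩ := exists_forall_mem_convexHull_of_card_lt P
  refine ⟨x, fun m => ?_⟩
  set d := finrank ℝ E
  induction m with
  | zero => exact fun _ => ⟨fun _ => ∅, by simp⟩
  | succ m ih =>
    intro hm
    obtain ⟨F, hF, hdisj⟩ := ih (by nlinarith)
    set U := (Finset.range m).biUnion F
    have hU : U ⊆ P := Finset.biUnion_subset.2 fun i hi => (hF i (Finset.mem_range.1 hi)).1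
    have hUcard : U.card ≤ m * (d + 1) := by
      simpa using Finset.card_biUnion_le_card_mul (Finset.range m) F (d + 1)
        fun i hi => (hF i (Finset.mem_range.1 hi)).2.1
    have hcard := Finset.card_sdiff_add_card_eq_card hU
    -- At most `m * (d + 1) < |P| / (d + 1)` points are used up, so the rest is large enough for the
    -- centerpoint property.
    have hmem := hx (P \ U) Finset.sdiff_subset (by nlinarith)
    rw [convexHull_eq_union] at hmem
    simp only [Set.mem_iUnion] at hmem
    obtain ⟨t, htU, htind, hxt⟩ := hmem
    rw [Finset.coe_subset] at htU
    have htcard : t.card ≤ d + 1 := by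
      have := htind.card_le_finrank_succ
      rw [Fintype.card_coe] at this
      exact this.trans (Nat.add_le_add_right (Submodule.finrank_le _) 1)
    have htF (i) (hi : i < m) : Disjoint t (F i) :=
      (Finset.disjoint_sdiff.symm.mono_left htU).mono_right
        (Finset.subset_biUnion_of_mem F (Finset.mem_range.2 hi))
    refine ⟨Function.update F m t, fun i hi => ?_, fun i hi j hj hij => ?_⟩
    · rcases (Nat.lt_succ_iff_lt_or_eq.1 hi) with hi | rfl
      · simpa [hi.ne] using hF i hi
      · simpa using ⟨htU.trans Finset.sdiff_subset, htcard, hxt⟩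
    · rcases (Nat.lt_succ_iff_lt_or_eq.1 hi) with hi | rfl <;>
        rcases (Nat.lt_succ_iff_lt_or_eq.1 hj) with hj | rfl
      · simpa [hi.ne, hj.ne] using hdisj i hi j hj hij
      · simpa [hi.ne] using (htF i hi).symm
      · simpa [hj.ne] using htF j hj
      · exact (hij rfl).elim

end Convex

/-! ### Vertices of a simplex. -/

section Hull
variable {E : Type*} [NormedAddCommGroup E] [NormedSpace ℝ E]

/-- By Krein–Milman the extreme points span the hull, so each vertex is in their affine span;
independence makes it one of them. -/
theorem AffineIndependent.extremePoints_convexHull {S : Finset E}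
    (hS : AffineIndependent ℝ ((↑) : S → E)) :
    (convexHull ℝ (S : Set E)).extremePoints ℝ = S := by
  refine extremePoints_convexHull_subset.antisymm fun a ha => ?_
  have hcpt : IsCompact (convexHull ℝ (S : Set E)) := S.finite_toSet.isCompact_convexHull ℝ
  set X := (convexHull ℝ (S : Set E)).extremePoints ℝ
  have hXS : X ⊆ S := extremePoints_convexHull_subset
  have hX := closure_convexHull_extremePoints hcpt (convex_convexHull ℝ _)
  rw [((S.finite_toSet.subset hXS).isCompact_convexHull ℝ).isClosed.closure_eq] at hX
  have haX : a ∈ affineSpan ℝ X :=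
    convexHull_subset_affineSpan X (hX ▸ subset_convexHull ℝ _ ha)
  have himage : ((↑) : S → E) '' ((↑) ⁻¹' X) = X :=
    Set.image_preimage_eq_of_subset (by simpa using hXS)
  exact (hS.mem_affineSpan_iff ⟨a, ha⟩ ((↑) ⁻¹' X)).1 (himage.symm ▸ haX)

end Hull

/-! ### Counting simplices through a point. -/

section GeneralPosition
variable {d : ℕ} {P : Finset (EuclideanSpace ℝ (Fin d))}

theorem InGeneralPosition.affineIndependent (hP : InGeneralPosition P)
    {S : Finset (EuclideanSpace ℝ (Fin d))} (hSP : S ⊆ P) (hS : S.card = d + 1) :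
    AffineIndependent ℝ ((↑) : S → EuclideanSpace ℝ (Fin d)) := by
  rw [affineIndependent_iff_finrank_vectorSpan_eq ℝ _ (by simpa using hS : Fintype.card S = d + 1)]
  by_contra hne
  set V := vectorSpan ℝ (Set.range ((↑) : S → EuclideanSpace ℝ (Fin d)))
  -- A nonzero normal to a proper direction space gives a hyperplane containing `S`.
  have hVtop : V ≠ ⊤ := by
    intro h
    rw [h] at hne
    simp at hne
  rw [ne_eq, ← Submodule.orthogonal_eq_bot_iff] at hVtop
  obtain ⟨v, hv, hv0⟩ := Submodule.exists_mem_ne_zero_of_ne_bot hVtop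
  obtain ⟨p, hp⟩ := Finset.card_pos.1 (by omega : 0 < S.card)
  refine hP S hSP hS _ ⟨v, hv0, inner ℝ v p, rfl⟩ fun q hq => ?_
  have : q - p ∈ V := vsub_mem_vectorSpan ℝ ⟨⟨q, hq⟩, rfl⟩ ⟨⟨p, hp⟩, rfl⟩
  have := Submodule.inner_left_of_mem_orthogonal this hv
  rw [inner_sub_right] at this
  exact sub_eq_zero.1 this

theorem InGeneralPosition.convexHull_injOn (hP : InGeneralPosition P) :
    Set.InjOn (fun S : Finset (EuclideanSpace ℝ (Fin d)) => convexHull ℝ (S : Set (EuclideanSpace ℝ (Fin d))))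
      {S | S ⊆ P ∧ S.card = d + 1} := by
  rintro S ⟨hSP, hS⟩ T ⟨hTP, hT⟩ h
  have := congrArg (Set.extremePoints ℝ) h
  simp only at this
  rwa [(hP.affineIndependent hSP hS).extremePoints_convexHull,
    (hP.affineIndependent hTP hT).extremePoints_convexHull, Finset.coe_inj] at this

/-- The last two conclusions allow `J` to be recovered from `S`. -/
theorem InGeneralPosition.exists_transversal (hP : InGeneralPosition P) {ι : Type*}
    {F : ι → Finset (EuclideanSpace ℝ (Fin d))} {J : Finset ι} (hJ : J.card = d + 1)
    (hFP : ∀ i ∈ J, F i ⊆ P) (hdisj : ∀ i ∈ J, ∀ j ∈ J, i ≠ j → Disjoint (F i) (F j))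
    {x : EuclideanSpace ℝ (Fin d)} (hx : ∀ i ∈ J, x ∈ convexHull ℝ (F i : Set (EuclideanSpace ℝ (Fin d)))) :
    ∃ S : Finset (EuclideanSpace ℝ (Fin d)), S ⊆ P ∧ S.card = d + 1 ∧
      x ∈ convexHull ℝ (S : Set (EuclideanSpace ℝ (Fin d))) ∧ (∀ i ∈ J, ∃ y ∈ S, y ∈ F i) ∧
      ∀ y ∈ S, ∃ i ∈ J, y ∈ F i := by
  classical
  have : Nonempty J := (Finset.card_pos.1 (by omega : 0 < J.card)).to_subtype
  have hinj (a : J → EuclideanSpace ℝ (Fin d)) (ha : ∀ i : J, a i ∈ F i) : Function.Injective a := by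
    intro i j hij
    by_contra hne
    exact Finset.disjoint_left.1 (hdisj i i.2 j j.2 fun h => hne (Subtype.ext h)) (ha i)
      (hij ▸ ha j)
  have hsub (a : J → EuclideanSpace ℝ (Fin d)) (ha : ∀ i : J, a i ∈ F i) :
      Finset.univ.image a ⊆ P := by
    intro y hy
    obtain ⟨i, -, rfl⟩ := Finset.mem_image.1 hy
    exact hFP i i.2 (ha i)
  have hcard (a : J → EuclideanSpace ℝ (Fin d)) (ha : ∀ i : J, a i ∈ F i) :
      (Finset.univ.image a).card = d + 1 := by
    rw [Finset.card_image_of_injective _ (hinj a ha), Finset.card_univ, Fintype.card_coe, hJ]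
  obtain ⟨a, ha, hxa⟩ := exists_transversal_mem_convexHull (F := fun i : J => F i)
    (fun i => hx i i.2) fun a ha v hv b => by
      by_contra! h
      refine hP _ (hsub a ha) (hcard a ha) _ ⟨v, hv, b, rfl⟩ ?_
      rintro y hy
      obtain ⟨i, -, rfl⟩ := Finset.mem_image.1 (Finset.mem_coe.1 hy)
      exact h i
  refine ⟨Finset.univ.image a, hsub a ha, hcard a ha, by simpa using hxa,
    fun i hi => ⟨a ⟨i, hi⟩, by simp, ha ⟨i, hi⟩⟩, fun y hy => ?_⟩
  obtain ⟨i, -, rfl⟩ := Finset.mem_image.1 hy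
  exact ⟨i, i.2, ha i⟩

theorem finite_setOf_mem_spannedSimplices (k : ℕ) (P : Finset (EuclideanSpace ℝ (Fin d)))
    (x : EuclideanSpace ℝ (Fin d)) : {Δ ∈ spannedSimplices k P | x ∈ Δ}.Finite := by
  refine (P.powerset.finite_toSet.image
    fun S : Finset (EuclideanSpace ℝ (Fin d)) => convexHull ℝ (S : Set _)).subset ?_
  rintro Δ ⟨⟨S, hSP, -, rfl⟩, -⟩
  exact ⟨S, by simpa using hSP, rfl⟩

theorem InGeneralPosition.choose_le_ncard (hP : InGeneralPosition P) {m : ℕ}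
    {F : ℕ → Finset (EuclideanSpace ℝ (Fin d))} {x : EuclideanSpace ℝ (Fin d)}
    (hF : ∀ i < m, F i ⊆ P ∧ x ∈ convexHull ℝ (F i : Set (EuclideanSpace ℝ (Fin d))))
    (hdisj : ∀ i < m, ∀ j < m, i ≠ j → Disjoint (F i) (F j)) :
    m.choose (d + 1) ≤ {Δ ∈ spannedSimplices d P | x ∈ Δ}.ncard := by
  classical
  have hlt {J : Finset ℕ} (hJ : J ∈ (Finset.range m).powersetCard (d + 1)) {i} (hi : i ∈ J) :
      i < m := Finset.mem_range.1 ((Finset.mem_powersetCard.1 hJ).1 hi)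
  have key (J) (hJ : J ∈ (Finset.range m).powersetCard (d + 1)) :=
    hP.exists_transversal (F := F) (x := x) (Finset.mem_powersetCard.1 hJ).2
      (fun i hi => (hF i (hlt hJ hi)).1)
      (fun i hi j hj => hdisj i (hlt hJ hi) j (hlt hJ hj))
      (fun i hi => (hF i (hlt hJ hi)).2)
  choose! S hSP hScard hxS hSF hFS using key
  have hsub (J) (hJ : J ∈ (Finset.range m).powersetCard (d + 1)) (J')
      (hJ' : J' ∈ (Finset.range m).powersetCard (d + 1)) (h : S J = S J') : J ⊆ J' := by
    intro i hi
    obtain ⟨y, hyS, hyi⟩ := hSF J hJ i hi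
    obtain ⟨j, hj, hyj⟩ := hFS J' hJ' y (h ▸ hyS)
    by_contra hiJ'
    exact Finset.disjoint_left.1 (hdisj i (hlt hJ hi) j (hlt hJ' hj)
      fun hij => hiJ' (hij ▸ hj)) hyi hyj
  have hinj : Set.InjOn (fun J => convexHull ℝ (S J : Set (EuclideanSpace ℝ (Fin d))))
      ((Finset.range m).powersetCard (d + 1)) := by
    intro J hJ J' hJ' h
    have hS := hP.convexHull_injOn ⟨hSP J hJ, hScard J hJ⟩ ⟨hSP J' hJ', hScard J' hJ'⟩ h
    exact (hsub J hJ J' hJ' hS).antisymm (hsub J' hJ' J hJ hS.symm)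
  have hmaps : ∀ J ∈ ((Finset.range m).powersetCard (d + 1) : Set (Finset ℕ)),
      convexHull ℝ (S J : Set (EuclideanSpace ℝ (Fin d))) ∈
        {Δ ∈ spannedSimplices d P | x ∈ Δ} :=
    fun J hJ => ⟨⟨S J, hSP J hJ, hScard J hJ, rfl⟩, hxS J hJ⟩
  have := Set.ncard_le_ncard_of_injOn _ hmaps hinj (finite_setOf_mem_spannedSimplices d P x)
  rwa [Set.ncard_coe_finset, Finset.card_powersetCard, Finset.card_range] at this

end GeneralPosition

/-! ### The constant and small cases. -/

theorem theorem1 (d : ℕ) :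
    ∃ c : ℝ, 0 < c ∧
      ∀ (n : ℕ) (P : Finset (EuclideanSpace ℝ (Fin d))), P.card = n → InGeneralPosition P →
        ∃ x : EuclideanSpace ℝ (Fin d),
          c * (n.choose (d + 1) : ℝ) ≤ ({Δ ∈ spannedSimplices d P | x ∈ Δ}.ncard : ℝ) := by
  have hpos : (0 : ℝ) < (((d + 1) ^ 3) ^ (d + 1) : ℕ) := by positivity
  refine ⟨((((d + 1) ^ 3) ^ (d + 1) : ℕ) : ℝ)⁻¹, inv_pos.2 hpos, fun n P hn hP => ?_⟩
  suffices h : ∃ x : EuclideanSpace ℝ (Fin d), n.choose (d + 1) ≤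
      ((d + 1) ^ 3) ^ (d + 1) * {Δ ∈ spannedSimplices d P | x ∈ Δ}.ncard by
    obtain ⟨x, hx⟩ := h
    refine ⟨x, ?_⟩
    rw [inv_mul_le_iff₀ hpos]
    exact_mod_cast hx
  obtain ⟨x, hx⟩ := exists_pairwiseDisjoint_mem_convexHull P
  simp only [finrank_euclideanSpace_fin, hn] at hx
  -- Chosen so that `m = q / (d + 1) ^ 2` is `n / (d + 1) ^ 2` rounded up.
  set q := n + (d + 1) ^ 2 - 1
  have hd : 0 < (d + 1) ^ 2 := by positivity
  have hq : q + 1 = n + (d + 1) ^ 2 := by omega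
  have hm₁ := Nat.div_mul_le_self q ((d + 1) ^ 2)
  have hm₂ := Nat.lt_div_mul_add (a := q) hd
  set m := q / (d + 1) ^ 2
  obtain ⟨F, hF, hdisj⟩ := hx m (by omega)
  have hle := choose_le_mul_choose_of_le_mul d.succ_pos (n := n) (m := m)
    (by rw [Nat.succ_eq_add_one]; omega)
  have hchoose := hP.choose_le_ncard (fun i hi => ⟨(hF i hi).1, (hF i hi).2.2⟩) hdisj
  rcases Nat.lt_or_ge n (d + 1) with hnd | hnd
  · exact ⟨x, by simp [Nat.choose_eq_zero_of_lt hnd]⟩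
  -- If `m < d + 1`, then `n.choose (d + 1)` is at most the constant, and a vertex of a single
  -- simplex suffices.
  rcases Nat.eq_zero_or_pos (m.choose (d + 1)) with hm | hm
  · obtain ⟨S, hSP, hS⟩ := Finset.exists_subset_card_eq (hn.symm ▸ hnd)
    obtain ⟨y, hy⟩ := Finset.card_pos.1 (by omega : 0 < S.card)
    refine ⟨y, hle.trans ?_⟩
    rw [hm, max_eq_left zero_le_one]
    gcongr
    exact (Set.ncard_pos (finite_setOf_mem_spannedSimplices d P y)).2
      ⟨_, ⟨S, hSP, hS, rfl⟩, subset_convexHull ℝ _ hy⟩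
  · refine ⟨x, hle.trans ?_⟩
    rw [max_eq_right hm]
    gcongr
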